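/- A \emph{gyrogroup} is a set $G$ with a binary operation $\oplus$ such that: there is $0\in G$ with $0\oplus x=x=x\oplus 0$ for all $x$; each $x$ has an inverse $\ominus x$ with $\ominus x\oplus x=0=x\oplus(\ominus x)$; for all $x,y\in G$ there is an automorphism $\mathrm{gyr}[x,y]$ of $(G,\oplus)$ with $x\oplus(y\oplus z)=(x\oplus y)\oplus\mathrm{gyr}[x,y](z)$ for all $z$; and $\mathrm{gyr}[x\oplus y,y]=\mathrm{gyr}[x,y]$ for all $x,y$. A set $A\subseteq G$ is \emph{gyr-invariant} if $\mathrm{gyr}[x,y](A)=A$ for all $x,y\in G$. A \emph{strongly topological gyrogroup} is a gyrogroup with a topology such that $\oplus:G\times G\to G$ and $x\mapsto\ominus x$ are continuous and every neighborhood of $0$ contains a gyr-invariant neighborhood of $0$. A \emph{strong subgyrogroup} is a nonempty gyr-invariant subset $H\subseteq G$ closed under $\oplus$ and $\ominus$. It is \emph{neutral} if for every neighborhood $U$ of $0$ there are open neighborhoods $V,V'$ of $0$ with $H\oplus V\subseteq U\oplus H$ and $V'\oplus H\subseteq H\oplus U$. The set $G/H=\{a\oplus H:a\in G\}$ of left cosets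 carries the quotient topology. A \emph{prefilter} on a space $X$ is a family $\zeta$ of nonempty subsets such that any $P_1,P_2\in\zeta$ admit $P\in\zeta$ with $P\subseteq P_1\cap P_2$. A family of subsets of $X$ \emph{converges} to $x\in X$ if every open neighborhood of $x$ contains a member of the family. Two families are \emph{synchronous} if each member of one meets each member of the other. The space $X$ is \emph{biradial} if for every $x\in X$ and every prefilter $\zeta$ on $X$ converging to $x$ there is a family $\eta$ of subsets of $X$, linearly ordered by inclusion, that converges to $x$ and is synchronous with $\zeta$. It has \emph{countable pseudocharacter} if $\{x\}$ is a $G_\delta$-set for every $x\in X$. \textbf{Theorem.} Let $G$ be a strongly topological gyrogroup and let $H$ be a closed neutral strong subgyrogroup of $G$. Then $G/H$ is metrizable if and only if $G/H$ is a biradial space with countable pseudocharacter. -/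

import Mathlib

open Topology
open scoped Pointwise

universe u

/-- A gyrogroup, written additively: `a + b` is the gyrosum `a ⊕ b`, `-a` is the inverse `⊖a`, and
`gyr x y` is the gyroautomorphism `gyr[x, y]`, an automorphism of the groupoid `(G, +)`.
Neither associativity nor commutativity is assumed. -/
class Gyrogroup (G : Type u) extends Add G, Zero G, Neg G where
  gyr : G → G → (G ≃+ G)
  zero_gyroadd : ∀ x : G, 0 + x = x
  gyroadd_zero : ∀ x : G, x + 0 = x
  neg_gyroadd : ∀ x : G, -x + x = 0
  gyroadd_neg : ∀ x : G, x + -x = 0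
  gyroassoc : ∀ x y z : G, x + (y + z) = (x + y) + gyr x y z
  gyr_loop : ∀ x y : G, gyr (x + y) y = gyr x y

namespace Gyrogroup

variable {G : Type u} [Gyrogroup G]

/-- A set `A` is gyr-invariant if `gyr[x, y] A = A` for all `x, y`. -/
def GyrInvariant (A : Set G) : Prop :=
  ∀ x y : G, (gyr x y : G → G) '' A = A

/-- A subgyrogroup: a nonempty subset closed under inverses and gyrosums. -/
structure IsSubgyrogroup (H : Set G) : Prop where
  nonempty : H.Nonempty
  neg_mem : ∀ a ∈ H, -a ∈ H
  add_mem : ∀ a ∈ H, ∀ b ∈ H, a + b ∈ H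

/-- A strong subgyrogroup: a gyr-invariant subgyrogroup. -/
structure IsStrongSubgyrogroup (H : Set G) : Prop extends IsSubgyrogroup H where
  gyrInvariant : GyrInvariant H

/-- The left coset `a ⊕ H`. -/
def leftCoset (a : G) (H : Set G) : Set G := (fun h => a + h) '' H

/-- The set `G/H` of left cosets: the quotient of `G` in which `a` and `b` are identified
exactly when `a ⊕ H = b ⊕ H`. -/
def LeftQuotient (H : Set G) : Type u :=
  Quotient (Setoid.ker fun a : G => leftCoset a H)

/-- The natural projection `G → G/H`, sending `a` to the coset `a ⊕ H`. -/
def LeftQuotient.mk (H : Set G) (a : G) : LeftQuotient H :=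
  Quotient.mk (Setoid.ker fun a : G => leftCoset a H) a

/-- The quotient topology: `O` is open iff its preimage under the natural projection is open. -/
instance [TopologicalSpace G] (H : Set G) : TopologicalSpace (LeftQuotient H) :=
  TopologicalSpace.coinduced (LeftQuotient.mk H) inferInstance

/-- `H` is inner neutral: every neighborhood `U` of `0` admits an open neighborhood `V` of `0`
with `H ⊕ V ⊆ U ⊕ H`. -/
def InnerNeutral [TopologicalSpace G] (H : Set G) : Prop :=
  ∀ U ∈ 𝓝 (0 : G), ∃ V : Set G, IsOpen V ∧ (0 : G) ∈ V ∧ H + V ⊆ U + H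

/-- `H` is outer neutral: every neighborhood `U` of `0` admits an open neighborhood `V` of `0`
with `V ⊕ H ⊆ H ⊕ U`. -/
def OuterNeutral [TopologicalSpace G] (H : Set G) : Prop :=
  ∀ U ∈ 𝓝 (0 : G), ∃ V : Set G, IsOpen V ∧ (0 : G) ∈ V ∧ V + H ⊆ H + U

/-- `H` is neutral: both inner and outer neutral. -/
def Neutral [TopologicalSpace G] (H : Set G) : Prop :=
  InnerNeutral H ∧ OuterNeutral H

end Gyrogroup

/-- A topological gyrogroup: gyroaddition is jointly continuous and inversion is continuous. -/
class IsTopologicalGyrogroup (G : Type u) [TopologicalSpace G] [Gyrogroup G] : Prop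
    extends ContinuousAdd G, ContinuousNeg G

/-- A strongly topological gyrogroup: moreover every neighborhood of `0` contains a gyr-invariant
neighborhood of `0`. -/
class IsStronglyTopologicalGyrogroup (G : Type u) [TopologicalSpace G] [Gyrogroup G] : Prop
    extends IsTopologicalGyrogroup G where
  exists_gyrInvariant_nhds : ∀ U ∈ 𝓝 (0 : G), ∃ V ∈ 𝓝 (0 : G),
    Gyrogroup.GyrInvariant V ∧ V ⊆ U

section Biradial

variable {X : Type u}

/-- A prefilter: a family of nonempty sets such that any two members contain a third in their
intersection. -/
def IsPrefilter (ζ : Set (Set X)) : Prop :=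
  (∀ P ∈ ζ, P.Nonempty) ∧ ∀ P₁ ∈ ζ, ∀ P₂ ∈ ζ, ∃ P ∈ ζ, P ⊆ P₁ ∩ P₂

/-- A family of sets converges to `x` if every open neighborhood of `x` contains a member. -/
def FamilyConvergesTo [TopologicalSpace X] (ζ : Set (Set X)) (x : X) : Prop :=
  ∀ U : Set X, IsOpen U → x ∈ U → ∃ P ∈ ζ, P ⊆ U

/-- Two families are synchronous if every member of one meets every member of the other. -/
def Synchronous (ζ η : Set (Set X)) : Prop :=
  ∀ P ∈ ζ, ∀ Q ∈ η, (P ∩ Q).Nonempty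

end Biradial

/-- A biradial space: for every prefilter converging to a point `x` there is a chain of sets
(with respect to inclusion) converging to `x` and synchronous with it. -/
def BiradialSpace (X : Type u) [TopologicalSpace X] : Prop :=
  ∀ (ζ : Set (Set X)) (x : X), IsPrefilter ζ → FamilyConvergesTo ζ x →
    ∃ η : Set (Set X), IsChain (· ⊆ ·) η ∧ FamilyConvergesTo η x ∧ Synchronous ζ η

/-- Countable pseudocharacter: every singleton is a `G_δ` set. -/
def CountablePseudocharacter (X : Type u) [TopologicalSpace X] : Prop :=
  ∀ x : X, IsGδ ({x} : Set X)

/-!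
The quotient `G/H` carries a uniformity compatible with its topology, whose entourages are
`{(a ⊕ H, (a ⊕ u) ⊕ H) : u ⊕ H ∈ B}` for `B` a neighbourhood of the coset `H`
(`leftQuotientUniformSpace`). Gyr-invariant neighbourhoods of `0` absorb the gyrations produced by
reassociating, and inner neutrality moves elements of `H` past small elements of `G`
(`exists_gyrInvariant_inner`). Consequently `G/H` is regular, it is `T₁` because `H` is closed, and
it is metrizable as soon as the single filter `𝓝 H` is countably generated.

To get this countability, let `F` be an ultrafilter finer than `𝓝 H` that contains all dense open
sets. Applying biradiality to the open members of `F` yields a chain synchronous with them; the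
closures of its members then lie in `F`, hence have nonempty interior, and regularity keeps these
interiors convergent to `H` (`BiradialSpace.exists_chain_isOpen`). If `P` runs through this chain,
the sets `{(⊖v ⊕ w) ⊕ H : v ⊕ H, w ⊕ H ∈ P}` form a chain of neighbourhoods of `H` which is a base
at `H`. A base at a `G_δ` point which is a chain contains a countable base, unless the point is
isolated (`isCountablyGenerated_nhds_of_isChain`).

Conversely, a decreasing countable base at a point of a first countable space is a chain
synchronous with every prefilter converging to that point.
-/

open Filter Set

/-! ### Biradial spaces -/

section Biradial

variable {X : Type u} [TopologicalSpace X]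

theorem BiradialSpace.of_firstCountable [FirstCountableTopology X] : BiradialSpace X := by
  intro ζ x hζ hconv
  obtain ⟨b, hb, hanti⟩ : ∃ b : ℕ → Set X,
      (𝓝 x).HasBasis (fun _ => True) b ∧ Antitone b := by
    obtain ⟨b, hb⟩ := (𝓝 x).exists_antitone_basis
    exact ⟨b, hb.1, hb.2⟩
  refine ⟨range b, ?_, ?_, ?_⟩
  · rintro _ ⟨m, rfl⟩ _ ⟨n, rfl⟩ -
    exact (le_total m n).symm.imp (fun h => hanti h) (fun h => hanti h)
  · intro U hU hx
    obtain ⟨n, -, hn⟩ := hb.mem_iff.1 (hU.mem_nhds hx)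
    exact ⟨b n, mem_range_self n, hn⟩
  · rintro P hP _ ⟨n, rfl⟩
    obtain ⟨P', hP', hsub⟩ := hconv (interior (b n)) isOpen_interior
      (mem_interior_iff_mem_nhds.2 (hb.mem_of_mem trivial))
    obtain ⟨P'', hP'', hsub'⟩ := hζ.2 P hP P' hP'
    obtain ⟨y, hy⟩ := hζ.1 P'' hP''
    exact ⟨y, (hsub' hy).1, interior_subset (hsub (hsub' hy).2)⟩

/-- The filter of sets containing a dense open set. -/
def denseOpenFilter (X : Type u) [TopologicalSpace X] : Filter X where
  sets := {s | Dense (interior s)}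
  univ_sets := by simp
  sets_of_superset hs hst := hs.mono (interior_mono hst)
  inter_sets hs ht := by
    simpa only [mem_ofPred_eq, interior_inter] using hs.inter_of_isOpen_left ht isOpen_interior

theorem exists_ultrafilter_le_nhds_denseOpenFilter (x : X) :
    ∃ F : Ultrafilter X, (F : Filter X) ≤ 𝓝 x ∧ (F : Filter X) ≤ denseOpenFilter X := by
  have : (𝓝 x ⊓ denseOpenFilter X).NeBot := by
    rw [inf_neBot_iff]
    intro s hs t ht
    obtain ⟨y, hy, hyt⟩ := Dense.inter_open_nonempty (show Dense (interior t) from ht)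
      (interior s) isOpen_interior ⟨x, mem_interior_iff_mem_nhds.2 hs⟩
    exact ⟨y, interior_subset hy, interior_subset hyt⟩
  obtain ⟨F, hF⟩ := Ultrafilter.exists_le (𝓝 x ⊓ denseOpenFilter X)
  exact ⟨F, hF.trans inf_le_left, hF.trans inf_le_right⟩

/-- Every point of a regular biradial space has a local `π`-base which is a chain. -/
theorem BiradialSpace.exists_chain_isOpen [RegularSpace X] (hX : BiradialSpace X) (x : X) :
    ∃ η : Set (Set X), IsChain (· ⊆ ·) η ∧ FamilyConvergesTo η x ∧
      ∀ P ∈ η, IsOpen P ∧ P.Nonempty := by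
  obtain ⟨F, hFx, hFd⟩ := exists_ultrafilter_le_nhds_denseOpenFilter x
  obtain ⟨η, hchain, hconv, hsync⟩ := hX {P | IsOpen P ∧ P ∈ F} x
    ⟨fun P hP => F.nonempty_of_mem hP.2, fun P₁ h₁ P₂ h₂ =>
      ⟨P₁ ∩ P₂, ⟨h₁.1.inter h₂.1, inter_mem h₁.2 h₂.2⟩, Subset.rfl⟩⟩
    (fun U hU hx => ⟨U, ⟨hU, hFx (hU.mem_nhds hx)⟩, Subset.rfl⟩)
  refine ⟨(fun Q => interior (closure Q)) '' η, ?_, ?_, ?_⟩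
  · rintro _ ⟨Q, hQ, rfl⟩ _ ⟨R, hR, rfl⟩ -
    exact (hchain.total hQ hR).imp (fun h => interior_mono (closure_mono h))
      (fun h => interior_mono (closure_mono h))
  · intro U hU hx
    obtain ⟨C, ⟨hC, hCc⟩, hCU⟩ := (closed_nhds_basis x).mem_iff.1 (hU.mem_nhds hx)
    obtain ⟨Q, hQ, hsub⟩ := hconv (interior C) isOpen_interior (mem_interior_iff_mem_nhds.2 hC)
    exact ⟨_, mem_image_of_mem _ hQ, interior_subset.trans
      ((closure_minimal (hsub.trans interior_subset) hCc).trans hCU)⟩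
  · rintro _ ⟨Q, hQ, rfl⟩
    refine ⟨isOpen_interior, ?_⟩
    have hmem : closure Q ∈ F := by
      by_contra hn
      obtain ⟨y, hy, hyQ⟩ := hsync (closure Q)ᶜ
        ⟨isClosed_closure.isOpen_compl, Ultrafilter.compl_mem_iff_notMem.2 hn⟩ Q hQ
      exact hy (subset_closure hyQ)
    by_contra hempty
    rw [not_nonempty_iff_eq_empty, interior_eq_empty_iff_dense_compl] at hempty
    -- Otherwise the complement of the closure is a dense open set, hence a member of `F`.
    have : (closure Q)ᶜ ∈ F := hFd <| show Dense (interior (closure Q)ᶜ) by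
      rwa [isClosed_closure.isOpen_compl.interior_eq]
    exact Ultrafilter.compl_mem_iff_notMem.1 this hmem

/-- A `G_δ` point with a neighbourhood base which is a chain has a countable base. -/
theorem isCountablyGenerated_nhds_of_isChain {x : X} (hx : IsGδ ({x} : Set X))
    {η : Set (Set X)} (hchain : IsChain (· ⊆ ·) η) (hconv : FamilyConvergesTo η x)
    (hnhds : ∀ B ∈ η, B ∈ 𝓝 x) : (𝓝 x).IsCountablyGenerated := by
  obtain ⟨f, hf, hfx⟩ := isGδ_iff_eq_iInter_nat.1 hx
  have hmem (n : ℕ) : x ∈ f n := mem_iInter.1 (hfx ▸ mem_singleton x) n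
  choose c hc hcf using fun n => hconv (f n) (hf n) (hmem n)
  by_cases h : ∀ B ∈ η, ∃ n, c n ⊆ B
  · have hb : (𝓝 x).HasBasis (fun _ : ℕ => True) c := by
      refine ⟨fun s => ⟨fun hs => ?_, fun ⟨n, _, hn⟩ => mem_of_superset (hnhds _ (hc n)) hn⟩⟩
      obtain ⟨B, hB, hBs⟩ := hconv (interior s) isOpen_interior (mem_interior_iff_mem_nhds.2 hs)
      obtain ⟨n, hn⟩ := h B hB
      exact ⟨n, trivial, hn.trans (hBs.trans interior_subset)⟩
    exact hb.isCountablyGenerated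
  · push Not at h
    obtain ⟨B, hB, hBc⟩ := h
    -- `B` lies in every `c n`, hence in `{x}`: the point is isolated.
    have hBx : B ⊆ {x} := by
      rw [hfx]
      exact subset_iInter fun n =>
        ((hchain.total hB (hc n)).resolve_right (hBc n)).trans (hcf n)
    have : 𝓝 x = pure x :=
      le_antisymm (le_pure_iff.2 (mem_of_superset (hnhds B hB) hBx)) (pure_le_nhds x)
    rw [this]
    infer_instance

end Biradial

/-! ### Algebra of gyrogroups -/

namespace Gyrogroup

variable {G : Type u} [Gyrogroup G]

theorem gyroadd_left_cancel {a b c : G} (h : a + b = a + c) : b = c := by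
  have h' : -a + (a + b) = -a + (a + c) := by rw [h]
  rw [gyroassoc, gyroassoc, neg_gyroadd, zero_gyroadd, zero_gyroadd] at h'
  exact (gyr (-a) a).injective h'

theorem gyr_zero_left (a z : G) : gyr 0 a z = z := by
  have h := gyroassoc 0 a z
  rw [zero_gyroadd, zero_gyroadd] at h
  exact (gyroadd_left_cancel h).symm

theorem neg_gyroadd_cancel_left (a b : G) : -a + (a + b) = b := by
  rw [gyroassoc, ← gyr_loop, neg_gyroadd, zero_gyroadd, gyr_zero_left]

theorem gyroadd_neg_cancel_left (a b : G) : a + (-a + b) = b := by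
  rw [gyroassoc, ← gyr_loop, gyroadd_neg, zero_gyroadd, gyr_zero_left]

theorem gyroassoc_symm (a b c : G) : (a + b) + c = a + (b + (gyr a b).symm c) := by
  rw [gyroassoc, AddEquiv.apply_symm_apply]

theorem gyr_apply_zero (a b : G) : gyr a b 0 = 0 := by
  apply gyroadd_left_cancel (a := gyr a b 0)
  rw [← map_add, zero_gyroadd, gyroadd_zero]

theorem eq_neg_of_gyroadd_eq_zero {a b : G} (h : a + b = 0) : b = -a :=
  gyroadd_left_cancel (h.trans (gyroadd_neg a).symm)

theorem gyr_apply_neg (a b c : G) : gyr a b (-c) = -gyr a b c := by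
  apply eq_neg_of_gyroadd_eq_zero
  rw [← map_add, gyroadd_neg, gyr_apply_zero]

/-- The gyrosum inversion law. -/
theorem neg_gyroadd_eq (a b : G) : -(a + b) = gyr a b (-b + -a) := by
  symm
  apply eq_neg_of_gyroadd_eq_zero
  rw [← gyroassoc, gyroadd_neg_cancel_left, gyroadd_neg]

theorem GyrInvariant.gyr_mem {A : Set G} (hA : GyrInvariant A) (x y : G) {a : G} (ha : a ∈ A) :
    gyr x y a ∈ A := by
  rw [← hA x y]
  exact mem_image_of_mem _ ha

theorem GyrInvariant.gyr_symm_mem {A : Set G} (hA : GyrInvariant A) (x y : G) {a : G}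
    (ha : a ∈ A) : (gyr x y).symm a ∈ A := by
  rw [← hA x y] at ha
  obtain ⟨b, hb, rfl⟩ := ha
  rwa [AddEquiv.symm_apply_apply]

/-! ### Cosets of a strong subgyrogroup -/

section Cosets

variable {H : Set G}

theorem IsSubgyrogroup.zero_mem (hH : IsSubgyrogroup H) : (0 : G) ∈ H := by
  obtain ⟨h, hh⟩ := hH.nonempty
  rw [← gyroadd_neg h]
  exact hH.add_mem _ hh _ (hH.neg_mem _ hh)

theorem IsStrongSubgyrogroup.leftCoset_gyroadd (hH : IsStrongSubgyrogroup H) (a : G) {h : G}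
    (hh : h ∈ H) : leftCoset (a + h) H = leftCoset a H := by
  apply Subset.antisymm
  · rintro _ ⟨k, hk, rfl⟩
    exact ⟨h + (gyr a h).symm k, hH.add_mem _ hh _ (hH.gyrInvariant.gyr_symm_mem _ _ hk),
      (gyroassoc_symm a h k).symm⟩
  · rintro _ ⟨k, hk, rfl⟩
    refine ⟨gyr a h (-h + k), hH.gyrInvariant.gyr_mem _ _
      (hH.add_mem _ (hH.neg_mem _ hh) _ hk), ?_⟩
    change a + h + gyr a h (-h + k) = a + k
    rw [← gyroassoc, gyroadd_neg_cancel_left]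

theorem LeftQuotient.mk_surjective (H : Set G) : Function.Surjective (LeftQuotient.mk H) :=
  Quotient.mk_surjective

theorem IsStrongSubgyrogroup.mk_eq_mk_iff (hH : IsStrongSubgyrogroup H) {a b : G} :
    LeftQuotient.mk H a = LeftQuotient.mk H b ↔ ∃ h ∈ H, a + h = b := by
  have key : LeftQuotient.mk H a = LeftQuotient.mk H b ↔ leftCoset a H = leftCoset b H :=
    Quotient.eq (r := Setoid.ker fun a : G => leftCoset a H)
  rw [key]
  constructor
  · intro h
    have hb : b ∈ leftCoset b H := ⟨0, hH.zero_mem, gyroadd_zero b⟩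
    rw [← h] at hb
    exact hb
  · rintro ⟨h, hh, rfl⟩
    exact (hH.leftCoset_gyroadd a hh).symm

theorem IsStrongSubgyrogroup.mk_gyroadd (hH : IsStrongSubgyrogroup H) (a : G) {h : G}
    (hh : h ∈ H) : LeftQuotient.mk H (a + h) = LeftQuotient.mk H a :=
  (hH.mk_eq_mk_iff.2 ⟨h, hh, rfl⟩).symm

theorem IsStrongSubgyrogroup.mk_gyroadd_congr (hH : IsStrongSubgyrogroup H) (c : G) {a b : G}
    (hab : LeftQuotient.mk H a = LeftQuotient.mk H b) :
    LeftQuotient.mk H (c + a) = LeftQuotient.mk H (c + b) := by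
  obtain ⟨h, hh, rfl⟩ := hH.mk_eq_mk_iff.1 hab
  rw [gyroassoc, hH.mk_gyroadd _ (hH.gyrInvariant.gyr_mem _ _ hh)]

/-- The relation on `G/H` consisting of the pairs `(x ⊕ H, (x ⊕ u) ⊕ H)` with `u ⊕ H ∈ B`. -/
def entourage (H : Set G) (B : Set (LeftQuotient H)) : Set (LeftQuotient H × LeftQuotient H) :=
  {p | ∃ x u : G, LeftQuotient.mk H x = p.1 ∧ LeftQuotient.mk H u ∈ B ∧
    LeftQuotient.mk H (x + u) = p.2}

theorem monotone_entourage (H : Set G) : Monotone (entourage H) :=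
  fun _ _ h _ ⟨x, u, hx, hu, hxu⟩ => ⟨x, u, hx, h hu, hxu⟩

theorem mem_entourage_image (hH : IsStrongSubgyrogroup H) {V : Set G}
    {p : LeftQuotient H × LeftQuotient H} (hp : p ∈ entourage H (LeftQuotient.mk H '' V)) :
    ∃ x, ∃ v ∈ V, LeftQuotient.mk H x = p.1 ∧ LeftQuotient.mk H (x + v) = p.2 := by
  obtain ⟨x, u, hx, ⟨v, hv, hvu⟩, hxu⟩ := hp
  exact ⟨x, v, hv, hx, (hH.mk_gyroadd_congr x hvu).trans hxu⟩

/-- The set of cosets `(⊖v ⊕ w) ⊕ H` with `v ⊕ H` and `w ⊕ H` in `P`. -/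
def differenceSet (H : Set G) (P : Set (LeftQuotient H)) : Set (LeftQuotient H) :=
  {p | ∃ v w : G, LeftQuotient.mk H v ∈ P ∧ LeftQuotient.mk H w ∈ P ∧
    LeftQuotient.mk H (-v + w) = p}

theorem monotone_differenceSet (H : Set G) : Monotone (differenceSet H) :=
  fun _ _ h _ ⟨v, w, hv, hw, hp⟩ => ⟨v, w, h hv, h hw, hp⟩

end Cosets

/-! ### Neighbourhoods in the coset space -/

section Topological

variable [TopologicalSpace G]

theorem map_gyroadd_nhds_zero [ContinuousAdd G] (x : G) : map (x + ·) (𝓝 (0 : G)) = 𝓝 x := by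
  let e : G ≃ₜ G :=
    { toFun := (x + ·)
      invFun := (-x + ·)
      left_inv := neg_gyroadd_cancel_left x
      right_inv := gyroadd_neg_cancel_left x
      continuous_toFun := by fun_prop
      continuous_invFun := by fun_prop }
  have h := e.map_nhds_eq 0
  have he : e 0 = x := gyroadd_zero x
  rwa [he] at h

theorem LeftQuotient.continuous_mk (H : Set G) : Continuous (LeftQuotient.mk H) :=
  continuous_coinduced_rng

theorem preimage_mk_mem_nhds_zero {H : Set G} {B : Set (LeftQuotient H)}
    (hB : B ∈ 𝓝 (LeftQuotient.mk H 0)) : LeftQuotient.mk H ⁻¹' B ∈ 𝓝 (0 : G) :=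
  (LeftQuotient.continuous_mk H).continuousAt hB

variable [IsStronglyTopologicalGyrogroup G] {H : Set G}

/-- Modulo `H` on the right, small elements can be moved from the right of `H` to its left. -/
theorem exists_gyrInvariant_inner (hH : IsStrongSubgyrogroup H) (hn : InnerNeutral H)
    {U : Set G} (hU : U ∈ 𝓝 (0 : G)) :
    ∃ V ∈ 𝓝 (0 : G), GyrInvariant V ∧ V ⊆ U ∧
      ∀ h ∈ H, ∀ v ∈ V, ∃ u ∈ U, LeftQuotient.mk H (h + v) = LeftQuotient.mk H u := by
  obtain ⟨W, hWo, hW0, hW⟩ := hn U hU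
  obtain ⟨V, hV, hVg, hVW⟩ :=
    IsStronglyTopologicalGyrogroup.exists_gyrInvariant_nhds (W ∩ U)
      (inter_mem (hWo.mem_nhds hW0) hU)
  refine ⟨V, hV, hVg, fun v hv => (hVW hv).2, fun h hh v hv => ?_⟩
  obtain ⟨u, hu, k, hk, huk⟩ := hW (add_mem_add hh (hVW hv).1)
  exact ⟨u, hu, by rw [← huk]; exact hH.mk_gyroadd u hk⟩

theorem isOpenMap_mk (hH : IsStrongSubgyrogroup H) (hn : InnerNeutral H) :
    IsOpenMap (LeftQuotient.mk H) := by
  intro O hO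
  change IsOpen (LeftQuotient.mk H ⁻¹' (LeftQuotient.mk H '' O))
  rw [isOpen_iff_mem_nhds]
  rintro y ⟨a, ha, hay⟩
  obtain ⟨h, hh, rfl⟩ := hH.mk_eq_mk_iff.1 hay
  have hU : (a + ·) ⁻¹' O ∈ 𝓝 (0 : G) := by
    have := hO.mem_nhds ha
    rwa [← map_gyroadd_nhds_zero a] at this
  obtain ⟨V, hV, hVg, -, hVU⟩ := exists_gyrInvariant_inner hH hn hU
  rw [← map_gyroadd_nhds_zero (a + h)]
  refine mem_map.2 (mem_of_superset hV fun v hv => ?_)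
  obtain ⟨u, hu, hmk⟩ := hVU h hh _ (hVg.gyr_symm_mem a h hv)
  refine ⟨a + u, hu, ?_⟩
  change _ = LeftQuotient.mk H (a + h + v)
  rw [gyroassoc_symm]
  exact hH.mk_gyroadd_congr a hmk.symm

theorem nhds_mk (hH : IsStrongSubgyrogroup H) (hn : InnerNeutral H) (x : G) :
    𝓝 (LeftQuotient.mk H x) = map (fun u => LeftQuotient.mk H (x + u)) (𝓝 (0 : G)) := by
  rw [← (isOpenMap_mk hH hn).map_nhds_eq (LeftQuotient.continuous_mk H).continuousAt,
    ← map_gyroadd_nhds_zero x, map_map]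
  rfl

theorem image_mk_mem_nhds (hH : IsStrongSubgyrogroup H) (hn : InnerNeutral H) {V : Set G}
    (hV : V ∈ 𝓝 (0 : G)) : LeftQuotient.mk H '' V ∈ 𝓝 (LeftQuotient.mk H 0) :=
  (isOpenMap_mk hH hn).image_mem_nhds hV

theorem t1Space_leftQuotient (hH : IsStrongSubgyrogroup H) (hc : IsClosed H) :
    T1Space (LeftQuotient H) := by
  refine ⟨fun p => ?_⟩
  obtain ⟨x, rfl⟩ := LeftQuotient.mk_surjective H p
  rw [← isOpen_compl_iff]
  change IsOpen (LeftQuotient.mk H ⁻¹' {LeftQuotient.mk H x}ᶜ)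
  rw [preimage_compl, isOpen_compl_iff]
  have : LeftQuotient.mk H ⁻¹' {LeftQuotient.mk H x} = (-x + ·) ⁻¹' H := by
    ext y
    rw [mem_preimage, mem_singleton_iff, eq_comm, hH.mk_eq_mk_iff]
    constructor
    · rintro ⟨h, hh, rfl⟩
      rwa [mem_preimage, neg_gyroadd_cancel_left]
    · exact fun h => ⟨_, h, gyroadd_neg_cancel_left x y⟩
  rw [this]
  exact hc.preimage (by fun_prop)

/-! ### The uniformity of the coset space -/

theorem entourage_symm (hH : IsStrongSubgyrogroup H) (hn : InnerNeutral H)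
    {B : Set (LeftQuotient H)} (hB : B ∈ 𝓝 (LeftQuotient.mk H 0)) :
    ∃ C ∈ 𝓝 (LeftQuotient.mk H 0), entourage H C ⊆ Prod.swap ⁻¹' entourage H B := by
  have hU : Neg.neg ⁻¹' (LeftQuotient.mk H ⁻¹' B) ∈ 𝓝 (0 : G) := by
    have h0 : -(0 : G) = 0 := (eq_neg_of_gyroadd_eq_zero (zero_gyroadd 0)).symm
    exact continuous_neg.continuousAt (by rw [h0]; exact preimage_mk_mem_nhds_zero hB)
  obtain ⟨V, hV, hVg, hVU⟩ := IsStronglyTopologicalGyrogroup.exists_gyrInvariant_nhds _ hU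
  refine ⟨_, image_mk_mem_nhds hH hn hV, ?_⟩
  rintro ⟨p, q⟩ hp
  obtain ⟨x, v, hv, rfl, rfl⟩ := mem_entourage_image hH hp
  refine ⟨x + v, gyr x v (-v), rfl, ?_, ?_⟩
  · rw [gyr_apply_neg]
    exact hVU (hVg.gyr_mem x v hv)
  · rw [← gyroassoc, gyroadd_neg, gyroadd_zero]
    rfl

theorem entourage_comp (hH : IsStrongSubgyrogroup H) (hn : InnerNeutral H)
    {B : Set (LeftQuotient H)} (hB : B ∈ 𝓝 (LeftQuotient.mk H 0)) :
    ∃ C ∈ 𝓝 (LeftQuotient.mk H 0), ∀ p q r, (p, q) ∈ entourage H C → (q, r) ∈ entourage H C →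
      (p, r) ∈ entourage H B := by
  have hU : (fun z : G × G => z.1 + z.2) ⁻¹' (LeftQuotient.mk H ⁻¹' B) ∈ 𝓝 (0 : G) ×ˢ 𝓝 0 := by
    rw [← nhds_prod_eq]
    exact continuous_add.continuousAt
      (by rw [zero_gyroadd]; exact preimage_mk_mem_nhds_zero hB)
  obtain ⟨W, hW, hWU⟩ := mem_prod_same_iff.1 hU
  obtain ⟨U, hU, hUg, hUW⟩ := IsStronglyTopologicalGyrogroup.exists_gyrInvariant_nhds W hW
  obtain ⟨V, hV, hVg, hVU, hVH⟩ := exists_gyrInvariant_inner hH hn hU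
  refine ⟨_, image_mk_mem_nhds hH hn hV, fun p q r hpq hqr => ?_⟩
  obtain ⟨x, v, hv, rfl, rfl⟩ := mem_entourage_image hH hpq
  obtain ⟨y, w, hw, hy, rfl⟩ := mem_entourage_image hH hqr
  obtain ⟨h, hh, rfl⟩ := hH.mk_eq_mk_iff.1 hy.symm
  -- `r` is the coset of `((x ⊕ v) ⊕ h) ⊕ w`; inner neutrality absorbs the discrepancy `h` between
  -- the two representatives of the middle coset.
  obtain ⟨u, hu, hmk⟩ := hVH h hh _ (hVg.gyr_symm_mem (x + v) h hw)
  refine ⟨x, v + (gyr x v).symm u, rfl,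
    hWU (mk_mem_prod (hUW (hVU hv)) (hUW (hUg.gyr_symm_mem x v hu))), ?_⟩
  rw [← gyroassoc_symm, gyroassoc_symm (x + v) h w]
  exact (hH.mk_gyroadd_congr (x + v) hmk).symm

theorem entourage_ball_mem_nhds (hH : IsStrongSubgyrogroup H) (hn : InnerNeutral H)
    {B : Set (LeftQuotient H)} (hB : B ∈ 𝓝 (LeftQuotient.mk H 0)) (p : LeftQuotient H) :
    Prod.mk p ⁻¹' entourage H B ∈ 𝓝 p := by
  obtain ⟨x, rfl⟩ := LeftQuotient.mk_surjective H p
  rw [nhds_mk hH hn]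
  exact mem_map.2 <| mem_of_superset (preimage_mk_mem_nhds_zero hB) fun u hu => ⟨x, u, rfl, hu, rfl⟩

theorem exists_entourage_ball_subset (hH : IsStrongSubgyrogroup H) (hn : InnerNeutral H)
    {p : LeftQuotient H} {S : Set (LeftQuotient H)} (hS : S ∈ 𝓝 p) :
    ∃ B ∈ 𝓝 (LeftQuotient.mk H 0), Prod.mk p ⁻¹' entourage H B ⊆ S := by
  obtain ⟨x, rfl⟩ := LeftQuotient.mk_surjective H p
  rw [nhds_mk hH hn] at hS
  obtain ⟨V, hV, hVg, -, hVH⟩ := exists_gyrInvariant_inner hH hn hS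
  refine ⟨_, image_mk_mem_nhds hH hn hV, fun q hq => ?_⟩
  obtain ⟨y, v, hv, hy, rfl⟩ := mem_entourage_image hH hq
  obtain ⟨h, hh, rfl⟩ := hH.mk_eq_mk_iff.1 hy.symm
  obtain ⟨u, hu, hmk⟩ := hVH h hh _ (hVg.gyr_symm_mem x h hv)
  rw [gyroassoc_symm, hH.mk_gyroadd_congr x hmk]
  exact hu

/-- The uniformity of `G/H` generated by the relations `entourage H B`, for `B` a neighbourhood of
the coset `H`. Its topology is the quotient topology. -/
@[reducible]
def leftQuotientUniformSpace (hH : IsStrongSubgyrogroup H) (hn : InnerNeutral H) :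
    UniformSpace (LeftQuotient H) where
  toTopologicalSpace := inferInstance
  uniformity := (𝓝 (LeftQuotient.mk H 0)).lift' (entourage H)
  symm := by
    rw [tendsto_lift']
    intro B hB
    obtain ⟨C, hC, hCB⟩ := entourage_symm hH hn hB
    exact mem_of_superset (mem_lift' hC) hCB
  comp := by
    intro s hs
    obtain ⟨B, hB, hBs⟩ := (mem_lift'_sets (monotone_entourage H)).1 hs
    obtain ⟨C, hC, hCB⟩ := entourage_comp hH hn hB
    refine mem_of_superset (mem_lift' (mem_lift' hC)) ?_
    rintro ⟨p, r⟩ ⟨q, hpq, hqr⟩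
    exact hBs (hCB p q r hpq hqr)
  nhds_eq_comap_uniformity := by
    intro p
    ext S
    rw [mem_comap]
    constructor
    · intro hS
      obtain ⟨B, hB, hBS⟩ := exists_entourage_ball_subset hH hn hS
      exact ⟨_, mem_lift' hB, hBS⟩
    · rintro ⟨T, hT, hTS⟩
      obtain ⟨B, hB, hBT⟩ := (mem_lift'_sets (monotone_entourage H)).1 hT
      exact mem_of_superset (entourage_ball_mem_nhds hH hn hB p)
        ((preimage_mono hBT).trans hTS)

/-! ### Metrizability -/

theorem metrizableSpace_leftQuotient (hH : IsStrongSubgyrogroup H) (hn : InnerNeutral H)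
    (hc : IsClosed H) (hcount : (𝓝 (LeftQuotient.mk H 0)).IsCountablyGenerated) :
    TopologicalSpace.MetrizableSpace (LeftQuotient H) := by
  let := leftQuotientUniformSpace hH hn
  have := t1Space_leftQuotient hH hc
  have : (uniformity (LeftQuotient H)).IsCountablyGenerated := by
    obtain ⟨b, hb⟩ := (𝓝 (LeftQuotient.mk H 0)).exists_antitone_basis
    exact (hb.1.lift' (monotone_entourage H)).isCountablyGenerated
  exact UniformSpace.metrizableSpace

theorem differenceSet_mem_nhds {P : Set (LeftQuotient H)}
    (hH : IsStrongSubgyrogroup H) (hn : InnerNeutral H) (hP : IsOpen P) (hne : P.Nonempty) :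
    differenceSet H P ∈ 𝓝 (LeftQuotient.mk H 0) := by
  obtain ⟨p, hp⟩ := hne
  obtain ⟨v, rfl⟩ := LeftQuotient.mk_surjective H p
  have h := hP.mem_nhds hp
  rw [nhds_mk hH hn] at h
  refine mem_of_superset (image_mk_mem_nhds hH hn h) ?_
  rintro _ ⟨u, hu, rfl⟩
  exact ⟨v, v + u, hp, hu, by rw [neg_gyroadd_cancel_left]⟩

/-- If representatives `w ⊕ h` and `w'` have small `w` and `w'`, then `⊖(w ⊕ h) ⊕ w'` equals
`h' ⊕ v` with `h' ∈ H` and `v` small, and inner neutrality puts its coset near `H`. -/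
theorem exists_differenceSet_subset (hH : IsStrongSubgyrogroup H) (hn : InnerNeutral H)
    {O : Set (LeftQuotient H)} (hO : O ∈ 𝓝 (LeftQuotient.mk H 0)) :
    ∃ B ∈ 𝓝 (LeftQuotient.mk H 0), differenceSet H B ⊆ O := by
  obtain ⟨V, hV, -, -, hVO⟩ := exists_gyrInvariant_inner hH hn (preimage_mk_mem_nhds_zero hO)
  have hU : (fun z : G × G => -z.1 + z.2) ⁻¹' V ∈ 𝓝 (0 : G) ×ˢ 𝓝 0 := by
    rw [← nhds_prod_eq]
    have hcont : Continuous fun z : G × G => -z.1 + z.2 := by fun_prop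
    exact hcont.continuousAt (by rw [neg_gyroadd]; exact hV)
  obtain ⟨U, hU, hUV⟩ := mem_prod_same_iff.1 hU
  obtain ⟨W, hW, hWg, hWU⟩ := IsStronglyTopologicalGyrogroup.exists_gyrInvariant_nhds U hU
  refine ⟨_, image_mk_mem_nhds hH hn hW, ?_⟩
  rintro _ ⟨v, v', ⟨w, hw, hwv⟩, ⟨w', hw', hwv'⟩, rfl⟩
  obtain ⟨h, hh, rfl⟩ := hH.mk_eq_mk_iff.1 hwv
  rw [← hH.mk_gyroadd_congr _ hwv', neg_gyroadd_eq, map_add, gyr_apply_neg w h w, gyroassoc_symm]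
  obtain ⟨u, hu, hmk⟩ := hVO _ (hH.gyrInvariant.gyr_mem w h (hH.neg_mem h hh)) _
    (hUV (mk_mem_prod (hWU (hWg.gyr_mem w h hw))
      (hWU (hWg.gyr_symm_mem (gyr w h (-h)) (-gyr w h w) hw'))))
  rw [hmk]
  exact hu

theorem isCountablyGenerated_nhds_mk_zero (hH : IsStrongSubgyrogroup H) (hn : InnerNeutral H)
    (hbi : BiradialSpace (LeftQuotient H))
    (hpc : IsGδ ({LeftQuotient.mk H 0} : Set (LeftQuotient H))) :
    (𝓝 (LeftQuotient.mk H 0)).IsCountablyGenerated := by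
  let := leftQuotientUniformSpace hH hn
  obtain ⟨η, hchain, hconv, hη⟩ := hbi.exists_chain_isOpen (LeftQuotient.mk H 0)
  refine isCountablyGenerated_nhds_of_isChain hpc (η := differenceSet H '' η) ?_ ?_ ?_
  · rintro _ ⟨P, hP, rfl⟩ _ ⟨Q, hQ, rfl⟩ -
    exact (hchain.total hP hQ).imp (fun h => monotone_differenceSet H h)
      (fun h => monotone_differenceSet H h)
  · intro O hO h0
    obtain ⟨B, hB, hBO⟩ := exists_differenceSet_subset hH hn (hO.mem_nhds h0)
    obtain ⟨P, hP, hPB⟩ := hconv (interior B) isOpen_interior (mem_interior_iff_mem_nhds.2 hB)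
    exact ⟨_, mem_image_of_mem _ hP,
      (monotone_differenceSet H (hPB.trans interior_subset)).trans hBO⟩
  · rintro _ ⟨P, hP, rfl⟩
    exact differenceSet_mem_nhds hH hn (hη P hP).1 (hη P hP).2

end Topological

end Gyrogroup

theorem mainTheorem2 (G : Type u) [TopologicalSpace G] [Gyrogroup G]
    [IsStronglyTopologicalGyrogroup G] (H : Set G)
    (hH : Gyrogroup.IsStrongSubgyrogroup H) (hclosed : IsClosed H)
    (hneutral : Gyrogroup.Neutral H) :
    TopologicalSpace.MetrizableSpace (Gyrogroup.LeftQuotient H) ↔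
      BiradialSpace (Gyrogroup.LeftQuotient H) ∧
        CountablePseudocharacter (Gyrogroup.LeftQuotient H) := by
  constructor
  · intro hm
    let := TopologicalSpace.metrizableSpaceMetric (Gyrogroup.LeftQuotient H)
    exact ⟨BiradialSpace.of_firstCountable, fun x => .singleton x⟩
  · rintro ⟨hbi, hpc⟩
    exact Gyrogroup.metrizableSpace_leftQuotient hH hneutral.1 hclosed
      (Gyrogroup.isCountablyGenerated_nhds_mk_zero hH hneutral.1 hbi (hpc _))
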